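/- Let $M$ be a connected smooth manifold (Hausdorff, second countable, without boundary) of dimension $p+q$, let $\mathcal F$ be a smooth foliation of $M$ with leaves of dimension $p$ and codimension $q$, and let $G$ be a Lie group of dimension $q$. Suppose that $\mathcal F$ is invariant under a transverse action of $G$: there is a smooth action $\Phi\colon G\times M\to M$ whose orbits have dimension $q$ and intersect the leaves of $\mathcal F$ transversely, and such that, for every $g\in G$, the map $\Phi_g\colon x\mapsto\Phi(g,x)$ takes leaves of $\mathcal F$ onto leaves of $\mathcal F$. Let $L$ be a leaf of $\mathcal F$, with its leaf topology and its structure of $p$-dimensional smooth manifold, and let $H(L)$ be the set of all $g\in G$ such that $\Phi(g,l)\in L$ for every $l\in L$. Then: (1) $H(L)$ is a (not necessarily closed) subgroup of $G$, and $g\in H(L)$ if and only if $\Phi(g,l)\in L$ for some $l\in L$. (2) The group $H(L)$, with the discrete topology, acts smoothly, properly and freely on $G\times L$ by $h\cdot(g,l)=(gh^{-1},\Phi(h,l))$. (3) The orbit space $(G\times L)/H(L)$, with the quotient topology, has a smooth manifold structure for which the canonical projection $\pi\colon G\times L\to (G\times L)/H(L)$ is a local diffeomorphism, and $\Phi$ induces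 a diffeomorphism $\Psi\colon (G\times L)/H(L)\to M$, $\Psi(\pi(g,l))=\Phi(g,l)$, which is $G$-equivariant for the action of $G$ on $(G\times L)/H(L)$ given by $a\cdot \pi(g,l)=\pi(ag,l)$. (4) The leaves of $\mathcal F$ are exactly the sets $\Psi(\pi(\{g\}\times L))$, $g\in G$. -/

import Mathlib

open scoped Manifold ContDiff Topology
open TopologicalSpace

noncomputable section

/-- A smooth foliation with leaves of dimension `p` and of codimension `q` on a smooth manifold `M`
of dimension `p + q`, given by a foliated atlas: smooth charts covering `M`, with values in open
subsets of `ℝ^p × ℝ^q`, whose changes of coordinates are locally of the form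
`(u, t) ↦ (a (u, t), b t)`. -/
structure Foliation (p q : ℕ) (M : Type*) [TopologicalSpace M]
    [ChartedSpace (EuclideanSpace ℝ (Fin (p + q))) M] where
  /-- the foliated charts -/
  charts : Set (OpenPartialHomeomorph M (EuclideanSpace ℝ (Fin p) × EuclideanSpace ℝ (Fin q)))
  contMDiffOn_chart : ∀ φ ∈ charts, ContMDiffOn (𝓡 (p + q))
    𝓘(ℝ, EuclideanSpace ℝ (Fin p) × EuclideanSpace ℝ (Fin q)) ∞ φ φ.source
  contMDiffOn_chart_symm : ∀ φ ∈ charts, ContMDiffOn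
    𝓘(ℝ, EuclideanSpace ℝ (Fin p) × EuclideanSpace ℝ (Fin q)) (𝓡 (p + q)) ∞ φ.symm φ.target
  exists_chart : ∀ x : M, ∃ φ ∈ charts, x ∈ φ.source
  compatible : ∀ φ ∈ charts, ∀ ψ ∈ charts, ∀ x ∈ φ.source ∩ ψ.source,
    ∃ b : EuclideanSpace ℝ (Fin q) → EuclideanSpace ℝ (Fin q),
      ∀ᶠ y in 𝓝 x, (ψ y).2 = b (φ y).2

namespace Foliation

variable {p q : ℕ} {M : Type*} [TopologicalSpace M]
  [ChartedSpace (EuclideanSpace ℝ (Fin (p + q))) M]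

/-- The manifold `M` equipped with the leaf topology of the foliation, as a type synonym of `M`. -/
def Leafwise (_F : Foliation p q M) : Type _ := M

/-- The identity map from `M` with the leaf topology to `M`. -/
def toM (F : Foliation p q M) (x : F.Leafwise) : M := x

/-- The identity map from `M` to `M` with the leaf topology. -/
def ofM (F : Foliation p q M) (x : M) : F.Leafwise := x

/-- The leaf topology: it is generated by the open subsets of the level sets of the transverse
coordinates `x ↦ (φ x).2` of the foliated charts `φ`. -/
instance (F : Foliation p q M) : TopologicalSpace F.Leafwise :=
  generateFrom {V : Set M | ∃ φ ∈ F.charts, ∃ U : Set M, IsOpen U ∧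
    ∃ t : EuclideanSpace ℝ (Fin q), V = {x | x ∈ U ∧ x ∈ φ.source ∧ (φ x).2 = t}}

theorem isOpen_level (F : Foliation p q M)
    {φ : OpenPartialHomeomorph M (EuclideanSpace ℝ (Fin p) × EuclideanSpace ℝ (Fin q))}
    (hφ : φ ∈ F.charts) {U : Set M} (hU : IsOpen U) (t : EuclideanSpace ℝ (Fin q)) :
    IsOpen {x : F.Leafwise | F.toM x ∈ U ∧ F.toM x ∈ φ.source ∧ (φ (F.toM x)).2 = t} :=
  isOpen_generateFrom_of_mem ⟨φ, hφ, U, hU, t, rfl⟩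

theorem continuous_toM (F : Foliation p q M) : Continuous F.toM := by
  refine continuous_def.2 fun U hU ↦ isOpen_iff_mem_nhds.2 fun x hx ↦ ?_
  obtain ⟨φ, hφ, hxφ⟩ := F.exists_chart (F.toM x)
  exact Filter.mem_of_superset
    ((F.isOpen_level hφ hU (φ (F.toM x)).2).mem_nhds ⟨hx, hxφ, rfl⟩) fun y hy ↦ hy.1

/-- The chart of `M` with the leaf topology obtained from a foliated chart `φ` by freezing the
transverse coordinate at `t`: it is `x ↦ (φ x).1`, with inverse `u ↦ φ.symm (u, t)`. -/
def leafChart (F : Foliation p q M)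
    (φ : OpenPartialHomeomorph M (EuclideanSpace ℝ (Fin p) × EuclideanSpace ℝ (Fin q)))
    (hφ : φ ∈ F.charts) (t : EuclideanSpace ℝ (Fin q)) :
    OpenPartialHomeomorph F.Leafwise (EuclideanSpace ℝ (Fin p)) where
  toFun x := (φ (F.toM x)).1
  invFun u := F.ofM (φ.symm (u, t))
  source := {x | F.toM x ∈ φ.source ∧ (φ (F.toM x)).2 = t}
  target := {u | (u, t) ∈ φ.target}
  map_source' := by
    rintro x ⟨hx, rfl⟩
    exact φ.map_source hx
  map_target' := by
    intro u hu
    exact ⟨φ.map_target hu, congrArg Prod.snd (φ.right_inv hu)⟩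
  left_inv' := by
    rintro x ⟨hx, rfl⟩
    exact φ.left_inv hx
  right_inv' := by
    intro u hu
    exact congrArg Prod.fst (φ.right_inv hu)
  open_source := by
    simpa using F.isOpen_level hφ isOpen_univ t
  open_target := φ.open_target.preimage (by fun_prop : Continuous fun u ↦ (u, t))
  continuousOn_toFun := by
    have h : ContinuousOn (fun x ↦ φ (F.toM x))
        {x : F.Leafwise | F.toM x ∈ φ.source ∧ (φ (F.toM x)).2 = t} :=
      φ.continuousOn.comp F.continuous_toM.continuousOn fun x hx ↦ hx.1
    exact continuous_fst.comp_continuousOn h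
  continuousOn_invFun := by
    have hc : ContinuousOn (fun u : EuclideanSpace ℝ (Fin p) ↦ φ.symm (u, t))
        {u | (u, t) ∈ φ.target} :=
      φ.continuousOn_symm.comp (by fun_prop : Continuous fun u ↦ (u, t)).continuousOn
        fun u hu ↦ hu
    have ho : IsOpen {u : EuclideanSpace ℝ (Fin p) | (u, t) ∈ φ.target} :=
      φ.open_target.preimage (by fun_prop : Continuous fun u ↦ (u, t))
    refine fun u hu ↦ tendsto_nhds_generateFrom_iff.2 ?_ |>.mono_left nhdsWithin_le_nhds
    rintro V ⟨ψ, hψ, U, hU, s, rfl⟩ ⟨huU, huψ, hus⟩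
    have huU' : φ.symm (u, t) ∈ U := huU
    have huψ' : φ.symm (u, t) ∈ ψ.source := huψ
    have hus' : (ψ (φ.symm (u, t))).2 = s := hus
    have hcu := hc.continuousAt (ho.mem_nhds hu)
    obtain ⟨b, hb⟩ := F.compatible φ hφ ψ hψ _ ⟨φ.map_target hu, huψ'⟩
    have hbu := hb.self_of_nhds
    rw [φ.right_inv hu, hus'] at hbu
    filter_upwards [hcu.eventually hb, hcu.eventually (hU.mem_nhds huU'),
      hcu.eventually (ψ.open_source.mem_nhds huψ'), ho.mem_nhds hu] with v h1 h2 h3 h4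
    refine ⟨h2, h3, ?_⟩
    rw [φ.right_inv h4] at h1
    exact h1.trans hbu.symm

/-- `M` with the leaf topology is a (usually not second countable) manifold of dimension `p`. -/
instance (F : Foliation p q M) : ChartedSpace (EuclideanSpace ℝ (Fin p)) F.Leafwise where
  atlas := {e | ∃ φ, ∃ hφ : φ ∈ F.charts, ∃ t, e = F.leafChart φ hφ t}
  chartAt x := F.leafChart (F.exists_chart (F.toM x)).choose
    (F.exists_chart (F.toM x)).choose_spec.1 ((F.exists_chart (F.toM x)).choose (F.toM x)).2
  mem_chart_source x := ⟨(F.exists_chart (F.toM x)).choose_spec.2, rfl⟩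
  chart_mem_atlas _ := ⟨_, _, _, rfl⟩

instance (F : Foliation p q M) : IsManifold (𝓡 p) ∞ F.Leafwise := by
  refine isManifold_of_contDiffOn _ _ _ ?_
  rintro _ _ ⟨φ, hφ, t, rfl⟩ ⟨ψ, hψ, s, rfl⟩
  have h1 : ContMDiffOn 𝓘(ℝ, EuclideanSpace ℝ (Fin p) × EuclideanSpace ℝ (Fin q))
      𝓘(ℝ, EuclideanSpace ℝ (Fin p) × EuclideanSpace ℝ (Fin q)) ∞ (ψ ∘ φ.symm)
      (φ.target ∩ φ.symm ⁻¹' ψ.source) :=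
    (F.contMDiffOn_chart ψ hψ).comp' (F.contMDiffOn_chart_symm φ hφ)
  have h2 : ContDiffOn ℝ ∞ (fun u : EuclideanSpace ℝ (Fin p) ↦ (ψ (φ.symm (u, t))).1)
      {u | (u, t) ∈ φ.target ∧ φ.symm (u, t) ∈ ψ.source} :=
    (h1.contDiffOn.comp (g := ψ ∘ φ.symm) (f := fun u ↦ (u, t)) (by fun_prop)
      fun u hu ↦ hu).fst
  refine h2.mono ?_
  rintro u ⟨⟨h3, h4⟩, -⟩
  exact ⟨h3, h4.1⟩

instance (F : Foliation p q M) : LocallyConnectedSpace F.Leafwise :=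
  ChartedSpace.locallyConnectedSpace (EuclideanSpace ℝ (Fin p)) F.Leafwise

/-- The leaves are the connected components for the leaf topology. Each leaf is an open
submanifold of `M` with the leaf topology, so it carries the leaf topology and a structure of
smooth manifold of dimension `p`. -/
def Leaf (F : Foliation p q M) : Type _ :=
  {L : Opens F.Leafwise // ∃ x : F.Leafwise, (L : Set F.Leafwise) = connectedComponent x}

/-- The leaf through a point. -/
def leafThrough (F : Foliation p q M) (x : M) : F.Leaf :=
  ⟨⟨connectedComponent (F.ofM x), isOpen_connectedComponent⟩, F.ofM x, rfl⟩

/-- A leaf as a subset of `M`. -/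
def Leaf.carrier {F : Foliation p q M} (L : F.Leaf) : Set M := {x | F.ofM x ∈ L.1}

/-- The tangent space at `x` of the leaf through `x`, as a subspace of the tangent space of `M`. -/
def tangentSpace (F : Foliation p q M) (x : M) : Submodule ℝ (TangentSpace (𝓡 (p + q)) x) :=
  LinearMap.range (mfderiv (𝓡 p) (𝓡 (p + q)) F.toM (F.ofM x)).toLinearMap

theorem Leaf.nonempty {F : Foliation p q M} (L : F.Leaf) : L.carrier.Nonempty := by
  obtain ⟨L, x, hx⟩ := L
  refine ⟨F.toM x, ?_⟩
  change x ∈ (L : Set F.Leafwise)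
  rw [hx]
  exact mem_connectedComponent

theorem Leaf.carrier_eq_of_mem {F : Foliation p q M} {L L' : F.Leaf} {x : M}
    (h : x ∈ L.carrier) (h' : x ∈ L'.carrier) : L.carrier = L'.carrier := by
  obtain ⟨L, y, hy⟩ := L
  obtain ⟨L', y', hy'⟩ := L'
  change F.ofM x ∈ (L : Set F.Leafwise) at h
  change F.ofM x ∈ (L' : Set F.Leafwise) at h'
  change (L : Set F.Leafwise) = (L' : Set F.Leafwise)
  rw [hy] at h ⊢
  rw [hy'] at h' ⊢
  exact (connectedComponent_eq h).trans (connectedComponent_eq h').symm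

/-- The foliation `F` is invariant under the transverse action of `G` (the given action of `G`
on `M`, where `G` is a Lie group whose dimension is the codimension of the foliation): the orbits
have dimension `q` and intersect the leaves transversely, and each element of `G` maps leaves onto
leaves. The tangent space at `g • x` of the orbit of `x` is the range of the derivative at `g` of
the orbit map. -/
structure IsInvariantUnderTransverseAction (F : Foliation p q M) (G : Type*) [TopologicalSpace G]
    [ChartedSpace (EuclideanSpace ℝ (Fin q)) G] [Group G] [MulAction G M] : Prop where
  finrank_orbit : ∀ (x : M) (g : G), Module.finrank ℝ
    (LinearMap.range (mfderiv (𝓡 q) (𝓡 (p + q)) (fun a : G ↦ a • x) g).toLinearMap) = q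
  transverse : ∀ (x : M) (g : G),
    LinearMap.range (mfderiv (𝓡 q) (𝓡 (p + q)) (fun a : G ↦ a • x) g).toLinearMap ⊔
      F.tangentSpace (g • x) = ⊤
  map_leaf : ∀ (g : G) (L : F.Leaf), ∃ L' : F.Leaf, (fun x : M ↦ g • x) '' L.carrier = L'.carrier

namespace IsInvariantUnderTransverseAction

variable {F : Foliation p q M} {G : Type*} [TopologicalSpace G]
    [ChartedSpace (EuclideanSpace ℝ (Fin q)) G] [Group G] [MulAction G M]

/-- The subgroup `H(L)` of the elements of `G` that map every point of the leaf `L` into `L`. -/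
def leafSubgroup (hF : F.IsInvariantUnderTransverseAction G) (L : F.Leaf) : Subgroup G where
  carrier := {g | ∀ x ∈ L.carrier, g • x ∈ L.carrier}
  mul_mem' := by
    intro a b ha hb x hx
    rw [mul_smul]
    exact ha _ (hb x hx)
  one_mem' := by
    intro x hx
    rwa [one_smul]
  inv_mem' := by
    intro g hg x hx
    obtain ⟨L', hL'⟩ := hF.map_leaf g L
    have h1 : g • x ∈ L'.carrier := hL' ▸ ⟨x, hx, rfl⟩
    have h2 : L.carrier = L'.carrier := Leaf.carrier_eq_of_mem (hg x hx) h1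
    obtain ⟨y, hy, hyx⟩ : x ∈ (fun x : M ↦ g • x) '' L.carrier := by
      rw [hL', ← h2]
      exact hx
    rw [← hyx]
    simpa using hy

/-- The group `H(L)`, which will be given the discrete topology (and not the topology induced by
that of `G`). -/
def LeafGroup (hF : F.IsInvariantUnderTransverseAction G) (L : F.Leaf) : Type _ :=
  hF.leafSubgroup L

variable (hF : F.IsInvariantUnderTransverseAction G) (L : F.Leaf)

instance : Group (hF.LeafGroup L) := inferInstanceAs (Group (hF.leafSubgroup L))

instance : TopologicalSpace (hF.LeafGroup L) := ⊥

instance : DiscreteTopology (hF.LeafGroup L) := ⟨rfl⟩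

/-- The inclusion of `H(L)` in `G`. -/
def incl : hF.LeafGroup L →* G := (hF.leafSubgroup L).subtype

/-- The action of `H(L)` on the leaf `L` by restriction of the action of `G` on `M`. -/
instance : MulAction (hF.LeafGroup L) L.1 where
  smul h l := ⟨F.ofM (hF.incl L h • F.toM l), Subtype.property h _ l.2⟩
  one_smul l := Subtype.ext (one_smul G (F.toM l))
  mul_smul h k l := Subtype.ext (mul_smul (hF.incl L h) (hF.incl L k) (F.toM l))

/-- The action of `H(L)` on `G × L` given by `h • (g, l) = (g * h⁻¹, h • l)`. -/
instance : MulAction (hF.LeafGroup L) (G × L.1) where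
  smul h z := (z.1 * (hF.incl L h)⁻¹, h • z.2)
  one_smul z := Prod.ext (by change z.1 * (hF.incl L 1)⁻¹ = z.1; simp) (one_smul _ z.2)
  mul_smul h k z := Prod.ext
    (by change z.1 * (hF.incl L (h * k))⁻¹ = z.1 * (hF.incl L k)⁻¹ * (hF.incl L h)⁻¹
        simp [mul_assoc])
    (mul_smul h k z.2)

/-- The orbit space `(G × L) / H(L)`, with the quotient topology. -/
abbrev AlgebraicModel : Type _ := MulAction.orbitRel.Quotient (hF.LeafGroup L) (G × L.1)

/-- The canonical projection `G × L → (G × L) / H(L)`. -/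
def proj (z : G × L.1) : hF.AlgebraicModel L := Quotient.mk _ z

/-- The action of `G` on `(G × L) / H(L)` given by `a • [(g, l)] = [(a * g, l)]`. -/
instance : MulAction G (hF.AlgebraicModel L) where
  smul a := Quotient.map (fun z : G × L.1 ↦ (a * z.1, z.2)) (by
    rintro _ z ⟨h, rfl⟩
    exact ⟨h, Prod.ext (mul_assoc _ _ _) rfl⟩)
  one_smul := by
    rintro ⟨z⟩
    exact congrArg (hF.proj L) (Prod.ext (one_mul z.1) rfl)
  mul_smul a b := by
    rintro ⟨z⟩
    exact congrArg (hF.proj L) (Prod.ext (mul_assoc a b z.1) rfl)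

end IsInvariantUnderTransverseAction

end Foliation

end

/-! Everything is read off from the map `sweep`, $(g,l)\mapsto g\cdot l$, from $G\times L$ to $M$.
Transversality makes its derivative at $(1,l)$ onto, hence invertible by dimension, and equivariance
carries this to every $(g,l)$; so `sweep` is a local diffeomorphism. Its fibres are the
$H(L)$-orbits, because an element of $G$ taking one point of $L$ into $L$ preserves $L$. Its range
is open, and so is the complement, which is a union of ranges for other leaves; as $M$ is connected,
`sweep` is onto. It therefore descends to a homeomorphism from the orbit space to $M$, along which
the smooth structure is pulled back. Properness follows from local injectivity of `sweep`, since $M$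
is Hausdorff.

The delicate point is that $H(L)$ acts smoothly for the leaf topology: mapping leaves onto leaves
does not obviously give leafwise continuity. By second countability a leaf meets each foliated chart
in countably many plaques, so the transverse coordinate is constant on connected sets that lie in a
leaf and in the chart (`continuous_leafwise`). -/

noncomputable section

/-! ### The inverse function theorem on manifolds -/

section InverseFunction

variable {E E' H H' N N' : Type*} [NormedAddCommGroup E] [NormedSpace ℝ E]
  [NormedAddCommGroup E'] [NormedSpace ℝ E'] [TopologicalSpace H] [TopologicalSpace H']
  {I : ModelWithCorners ℝ E H} {J : ModelWithCorners ℝ E' H'}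
  [TopologicalSpace N] [ChartedSpace H N] [TopologicalSpace N'] [ChartedSpace H' N']

theorem IsLocalDiffeomorphAt.congr_of_eventuallyEq {n : WithTop ℕ∞} {f g : N → N'} {x : N}
    (hf : IsLocalDiffeomorphAt I J n f x) (h : g =ᶠ[𝓝 x] f) :
    IsLocalDiffeomorphAt I J n g x := by
  obtain ⟨Φ, hx, hΦ⟩ := hf
  obtain ⟨s, hs, ho, hxs⟩ := mem_nhds_iff.1 h
  refine ⟨{ Φ.toOpenPartialHomeomorph.restrOpen s ho with
    open_source := (Φ.toOpenPartialHomeomorph.restrOpen s ho).open_source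
    open_target := (Φ.toOpenPartialHomeomorph.restrOpen s ho).open_target
    contMDiffOn_toFun := Φ.contMDiffOn_toFun.mono fun y hy ↦ hy.1
    contMDiffOn_invFun := Φ.contMDiffOn_invFun.mono fun y hy ↦ hy.1 }, ⟨hx, hxs⟩, ?_⟩
  intro y hy
  exact (hs hy.2).trans (hΦ hy.1)

/-- The smooth inverse function theorem in a Banach space. -/
theorem ContDiffOn.isLocalDiffeomorphAt_of_isInvertible [CompleteSpace E] {f : E → E'} {s : Set E}
    (hs : IsOpen s) (hf : ContDiffOn ℝ ∞ f s) (hf' : ∀ y ∈ s, (fderiv ℝ f y).IsInvertible)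
    {x : E} (hx : x ∈ s) : IsLocalDiffeomorphAt 𝓘(ℝ, E) 𝓘(ℝ, E') ∞ f x := by
  have hfd : ∀ y ∈ s, HasFDerivAt f (fderiv ℝ f y) y := fun y hy ↦
    ((hf.contDiffAt (hs.mem_nhds hy)).differentiableAt (by simp)).hasFDerivAt
  obtain ⟨A, hA⟩ := hf' x hx
  let e := (hf.contDiffAt (hs.mem_nhds hx)).toOpenPartialHomeomorph f
    (hA ▸ hfd x hx) (by simp)
  have he : (e : E → E') = f := rfl
  have hxe : x ∈ e.source := ContDiffAt.mem_toOpenPartialHomeomorph_source _ _ _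
  -- Inside `s` the derivative is invertible everywhere, so the inverse is smooth on the whole
  -- target and not only at `f x`.
  let e' := e.restrOpen s hs
  refine ⟨{ e' with
    open_source := e'.open_source
    open_target := e'.open_target
    contMDiffOn_toFun := (hf.mono fun y hy ↦ hy.2).contMDiffOn
    contMDiffOn_invFun := ContDiffOn.contMDiffOn fun y hy ↦ ?_ }, ⟨hxe, hx⟩, fun y hy ↦ rfl⟩
  have hy' : e'.symm y ∈ s := (e'.map_target hy).2
  obtain ⟨B, hB⟩ := hf' _ hy'
  exact (e'.contDiffAt_symm hy (hB ▸ hfd _ hy') (hf.contDiffAt (hs.mem_nhds hy'))).contDiffWithinAt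

theorem isLocalDiffeomorphAt_extChartAt [I.Boundaryless] [IsManifold I ∞ N] {x y : N}
    (hy : y ∈ (extChartAt I x).source) :
    IsLocalDiffeomorphAt I 𝓘(ℝ, E) ∞ (extChartAt I x) y :=
  ⟨{ extChartAt I x with
    open_source := isOpen_extChartAt_source x
    open_target := isOpen_extChartAt_target x
    contMDiffOn_toFun := by
      have := contMDiffOn_extChartAt (I := I) (n := ∞) (x := x)
      rwa [← extChartAt_source I] at this
    contMDiffOn_invFun := contMDiffOn_extChartAt_symm x }, hy, fun y hy ↦ rfl⟩

theorem isLocalDiffeomorphAt_extChartAt_symm [I.Boundaryless] [IsManifold I ∞ N] {x : N} {y : E}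
    (hy : y ∈ (extChartAt I x).target) :
    IsLocalDiffeomorphAt 𝓘(ℝ, E) I ∞ (extChartAt I x).symm y :=
  ⟨{ (extChartAt I x).symm with
    open_source := isOpen_extChartAt_target x
    open_target := isOpen_extChartAt_source x
    contMDiffOn_invFun := by
      have := contMDiffOn_extChartAt (I := I) (n := ∞) (x := x)
      rwa [← extChartAt_source I] at this
    contMDiffOn_toFun := contMDiffOn_extChartAt_symm x }, hy, fun y hy ↦ rfl⟩

theorem IsLocalDiffeomorphAt.isInvertible_mfderiv [IsManifold I ∞ N] [IsManifold J ∞ N']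
    {f : N → N'} {x : N} (hf : IsLocalDiffeomorphAt I J ∞ f x) :
    (mfderiv I J f x).IsInvertible :=
  ⟨hf.mfderivToContinuousLinearEquiv (by simp), hf.mfderivToContinuousLinearEquiv_coe (by simp)⟩

/-- The inverse function theorem: a smooth map between manifolds without boundary whose
derivatives are all invertible is a local diffeomorphism. -/
theorem ContMDiff.isLocalDiffeomorph_of_isInvertible [CompleteSpace E] [I.Boundaryless]
    [J.Boundaryless] [IsManifold I ∞ N] [IsManifold J ∞ N'] {f : N → N'} (hf : ContMDiff I J ∞ f)
    (hf' : ∀ x, (mfderiv I J f x).IsInvertible) : IsLocalDiffeomorph I J ∞ f := by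
  intro x
  let φ := extChartAt I x
  let ψ := extChartAt J (f x)
  let s : Set E := φ.target ∩ (f ∘ φ.symm) ⁻¹' ψ.source
  have hs : IsOpen s :=
    (hf.continuous.comp_continuousOn (continuousOn_extChartAt_symm x)).isOpen_inter_preimage
      (isOpen_extChartAt_target x) (isOpen_extChartAt_source _)
  have hψ : ∀ z ∈ s, IsLocalDiffeomorphAt J 𝓘(ℝ, E') ∞ ψ (f (φ.symm z)) := fun z hz ↦
    isLocalDiffeomorphAt_extChartAt hz.2
  have hφ : ∀ z ∈ s, IsLocalDiffeomorphAt 𝓘(ℝ, E) I ∞ φ.symm z := fun z hz ↦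
    isLocalDiffeomorphAt_extChartAt_symm hz.1
  have hF : ∀ z ∈ s, ContMDiffAt 𝓘(ℝ, E) 𝓘(ℝ, E') ∞ (ψ ∘ f ∘ φ.symm) z := fun z hz ↦
    (hψ z hz).contMDiffAt.comp z ((hf _).comp z (hφ z hz).contMDiffAt)
  have hF' : ∀ z ∈ s, (fderiv ℝ (ψ ∘ f ∘ φ.symm) z).IsInvertible := by
    intro z hz
    have hfz := (hf (φ.symm z)).mdifferentiableAt (by simp : (∞ : WithTop ℕ∞) ≠ 0)
    have hφz := (hφ z hz).mdifferentiableAt (by simp)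
    have hψz := (hψ z hz).mdifferentiableAt (by simp)
    rw [← mfderiv_eq_fderiv, mfderiv_comp z hψz (hfz.comp z hφz), mfderiv_comp z hfz hφz]
    exact (hψ z hz).isInvertible_mfderiv.comp ((hf' _).comp (hφ z hz).isInvertible_mfderiv)
  have hxs : φ x ∈ s := ⟨mem_extChartAt_target x, by simp [φ, ψ]⟩
  have hx : φ.symm (φ x) = x := extChartAt_to_inv x
  have h1 : IsLocalDiffeomorphAt 𝓘(ℝ, E) 𝓘(ℝ, E') ∞ (ψ ∘ f ∘ φ.symm) (φ x) :=
    ContDiffOn.isLocalDiffeomorphAt_of_isInvertible hs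
      (fun z hz ↦ (hF z hz).contDiffAt.contDiffWithinAt) hF' hxs
  have h2 := (isLocalDiffeomorphAt_extChartAt (mem_extChartAt_source (I := I) x)).comp _ _ h1
  have h3 : IsLocalDiffeomorphAt 𝓘(ℝ, E') J ∞ ψ.symm (((ψ ∘ f ∘ φ.symm) ∘ φ) x) := by
    refine isLocalDiffeomorphAt_extChartAt_symm ?_
    simp [hx, ψ]
  refine (h2.comp _ _ h3).congr_of_eventuallyEq ?_
  filter_upwards [extChartAt_source_mem_nhds (I := I) x,
    hf.continuous.continuousAt (extChartAt_source_mem_nhds (I := J) (f x))] with y hy hy'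
  have hyx : φ.symm (φ y) = y := φ.left_inv hy
  simp only [Function.comp_apply]
  erw [hyx]
  exact (ψ.left_inv hy').symm

end InverseFunction

/-! ### Separability of connected components -/

section Separable

theorem ContinuousOn.isSeparable_image' {X Y : Type*} [TopologicalSpace X]
    [SecondCountableTopology X] [TopologicalSpace Y] {f : X → Y} {s : Set X}
    (hf : ContinuousOn f s) : IsSeparable (f '' s) := by
  rw [Set.image_eq_range]
  exact isSeparable_range (continuousOn_iff_continuous_domRestrict.1 hf)

/-- Each such `U i` contains a point of a countable set whose closure contains `s`; disjointness
makes the choice of point injective. -/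
theorem TopologicalSpace.IsSeparable.countable_setOf_inter_nonempty {X ι : Type*}
    [TopologicalSpace X] {s : Set X} (hs : IsSeparable s) {U : ι → Set X}
    (hU : ∀ i, IsOpen (U i)) (hd : Pairwise (Function.onFun Disjoint U)) :
    {i | (U i ∩ s).Nonempty}.Countable := by
  obtain ⟨c, hc, hsc⟩ := hs
  have h : ∀ i ∈ {i | (U i ∩ s).Nonempty}, ∃ x ∈ c, x ∈ U i := by
    rintro i ⟨x, hxU, hxs⟩
    obtain ⟨y, hy, hyc⟩ := mem_closure_iff.1 (hsc hxs) _ (hU i) hxU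
    exact ⟨y, hyc, hy⟩
  obtain hX | hX := isEmpty_or_nonempty X
  · exact Set.countable_empty.mono fun i hi ↦ (hX.false hi.some).elim
  choose! f hfc hfU using h
  refine Set.MapsTo.countable_of_injOn (f := f) (fun i hi ↦ hfc i hi) ?_ hc
  intro i hi j hj hij
  by_contra hne
  exact Set.disjoint_left.1 (hd hne) (hfU i hi) (hij ▸ hfU j hj)

/-- If countably many families of pairwise disjoint separable open sets cover a space, then its
connected components are separable. -/
theorem isSeparable_connectedComponent_of_iUnion {X ι κ : Type*} [TopologicalSpace X] [Countable ι]
    {U : ι → κ → Set X} (hU : ∀ i k, IsOpen (U i k))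
    (hd : ∀ i, Pairwise (Function.onFun Disjoint (U i))) (hs : ∀ i k, IsSeparable (U i k))
    (hc : ∀ x, ∃ i k, x ∈ U i k) (x : X) : IsSeparable (connectedComponent x) := by
  let V : Set (ι × κ) → Set X := fun J ↦ ⋃ j ∈ J, U j.1 j.2
  have hVo : ∀ J, IsOpen (V J) := fun J ↦ isOpen_biUnion fun j _ ↦ hU _ _
  have hVs : ∀ J, J.Countable → IsSeparable (V J) := by
    intro J hJ
    have := hJ.to_subtype
    simp only [V, Set.biUnion_eq_iUnion]
    exact .iUnion fun j ↦ hs _ _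
  -- Adjoin all sets meeting those already reached; iterating gives the sets linked by finite chains
  -- to the one containing `x`.
  let next : Set (ι × κ) → Set (ι × κ) := fun J ↦ {j | (U j.1 j.2 ∩ V J).Nonempty}
  have hnext : ∀ J, J.Countable → (next J).Countable := by
    intro J hJ
    have h : next J ⊆ ⋃ i : ι, Prod.mk i '' {k | (U i k ∩ V J).Nonempty} := by
      rintro ⟨i, k⟩ hj
      exact Set.mem_iUnion.2 ⟨i, k, hj, rfl⟩
    exact (Set.countable_iUnion fun i ↦
      ((hVs J hJ).countable_setOf_inter_nonempty (hU i) (hd i)).image _).mono h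
  obtain ⟨i, k, hx⟩ := hc x
  let J : ℕ → Set (ι × κ) := fun n ↦ next^[n] {(i, k)}
  have hJ : ∀ n, (J n).Countable := by
    intro n
    induction n with
    | zero => exact Set.countable_singleton _
    | succ n ih =>
      simp only [J, Function.iterate_succ_apply']
      exact hnext _ ih
  let W := ⋃ n, V (J n)
  have hW : IsClopen W := by
    -- A member of the cover around a closure point meets stage `n` for some `n`, so it is adjoined
    -- at stage `n + 1`.
    refine ⟨isClosed_of_closure_subset fun y hy ↦ ?_, isOpen_iUnion fun n ↦ hVo _⟩
    obtain ⟨i', k', hyU⟩ := hc y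
    obtain ⟨z, hzU, hzW⟩ := mem_closure_iff.1 hy _ (hU i' k') hyU
    obtain ⟨n, hn⟩ := Set.mem_iUnion.1 hzW
    refine Set.mem_iUnion.2 ⟨n + 1, Set.mem_biUnion (x := (i', k')) ?_ hyU⟩
    simp only [J, Function.iterate_succ_apply']
    exact ⟨z, hzU, hn⟩
  have hxW : x ∈ W := Set.mem_iUnion.2 ⟨0, Set.mem_biUnion (x := (i, k)) rfl hx⟩
  exact (IsSeparable.iUnion fun n ↦ hVs _ (hJ n)).mono (hW.connectedComponent_subset hxW)

end Separable

/-! ### Proper actions of discrete groups -/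

section ProperAction

/-- A free action of a discrete group by homeomorphisms is proper if its orbits are the fibres of
a continuous, locally injective map to a Hausdorff space. -/
theorem properSMul_of_locally_injective {Γ X Y : Type*} [Group Γ] [TopologicalSpace Γ]
    [DiscreteTopology Γ] [TopologicalSpace X] [MulAction Γ X] [ContinuousConstSMul Γ X]
    [TopologicalSpace Y] [T2Space Y] {f : X → Y} (hf : Continuous f)
    (hinj : ∀ x, ∃ s ∈ 𝓝 x, Set.InjOn f s) (hfib : ∀ x y, f x = f y ↔ ∃ γ : Γ, γ • y = x)
    (hfree : ∀ (γ : Γ) (x : X), γ • x = x → γ = 1) : ProperSMul Γ X := by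
  have hinv : ∀ (γ : Γ) x, f (γ • x) = f x := fun γ x ↦ (hfib _ _).2 ⟨γ, rfl⟩
  refine ⟨isProperMap_iff_ultrafilter.2 ⟨?_, ?_⟩⟩
  · refine continuous_prod_of_discrete_left.2 fun γ ↦ ?_
    exact (continuous_const_smul γ).prodMk continuous_id
  · rintro 𝒰 ⟨y, z⟩ h
    have hy : Filter.Tendsto (fun a : Γ × X ↦ a.1 • a.2) 𝒰 (𝓝 y) := (Prod.tendsto_iff _ _).1 h |>.1
    have hz : Filter.Tendsto (fun a : Γ × X ↦ a.2) 𝒰 (𝓝 z) := (Prod.tendsto_iff _ _).1 h |>.2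
    have h1 : Filter.Tendsto (fun a : Γ × X ↦ f a.2) 𝒰 (𝓝 (f y)) := by
      simpa only [Function.comp_def, hinv] using (hf.tendsto y).comp hy
    -- The two limits have the same image under `f`, so they lie in one orbit.
    obtain ⟨γ, rfl⟩ := (hfib y z).1 (tendsto_nhds_unique h1 ((hf.tendsto z).comp hz))
    obtain ⟨s, hs, hsi⟩ := hinj (γ • z)
    refine ⟨(γ, z), rfl, ?_⟩
    rw [nhds_prod_eq, nhds_discrete]
    refine Filter.tendsto_id.mono_right ?_
    -- Both `a.1 • a.2` and `γ • a.2` end up in `s`, where `f` is injective; freeness then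
    -- identifies the group elements.
    have h2 : ∀ᶠ a : Γ × X in 𝒰, a.1 = γ := by
      filter_upwards [hy hs, (((continuous_const_smul γ).tendsto z).comp hz) hs] with a ha ha'
      have h3 : a.1 • a.2 = γ • a.2 := hsi ha ha' ((hinv _ _).trans (hinv _ _).symm)
      have h4 := hfree (γ⁻¹ * a.1) a.2 (by rw [mul_smul, h3, inv_smul_smul])
      exact (inv_mul_eq_one.1 h4).symm
    have h5 : Filter.Tendsto (fun a : Γ × X ↦ a.1) 𝒰 (pure γ) := Filter.tendsto_pure.2 h2
    exact h5.prodMk hz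

end ProperAction


/-! ### Linear algebra, open submanifolds and transport of smooth structure -/

section Manifolds

theorem ContinuousLinearMap.isInvertible_of_surjective_of_finrank_eq {V W : Type*}
    [NormedAddCommGroup V] [NormedSpace ℝ V] [FiniteDimensional ℝ V]
    [NormedAddCommGroup W] [NormedSpace ℝ W] [FiniteDimensional ℝ W] {A : V →L[ℝ] W}
    (hA : Function.Surjective A) (h : Module.finrank ℝ V = Module.finrank ℝ W) :
    A.IsInvertible := by
  have hi : Function.Injective A :=
    (LinearMap.injective_iff_surjective_of_finrank_eq_finrank h (f := A.toLinearMap)).2 hA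
  exact ⟨(LinearEquiv.ofBijective A.toLinearMap ⟨hi, hA⟩).toContinuousLinearEquiv, by ext; rfl⟩

variable {E H N E' H' N' : Type*} [NormedAddCommGroup E] [NormedSpace ℝ E]
  [TopologicalSpace H] {I : ModelWithCorners ℝ E H} [TopologicalSpace N] [ChartedSpace H N]
  [NormedAddCommGroup E'] [NormedSpace ℝ E'] [TopologicalSpace H']
  {J : ModelWithCorners ℝ E' H'} [TopologicalSpace N'] [ChartedSpace H' N']

theorem TopologicalSpace.Opens.isLocalDiffeomorph_subtypeVal (U : Opens N) :
    IsLocalDiffeomorph I I ∞ (Subtype.val : U → N) := by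
  intro x
  let e := U.openPartialHomeomorphSubtypeCoe ⟨x⟩
  refine ⟨{ e with
    open_source := e.open_source
    open_target := e.open_target
    contMDiffOn_toFun := (contMDiff_subtype_val (I := I)).contMDiffOn
    contMDiffOn_invFun := fun y hy ↦ ContMDiffAt.contMDiffWithinAt ?_ }, trivial, fun y _ ↦ rfl⟩
  have h : ContMDiffAt I I ∞ (Subtype.val ∘ e.symm) y := by
    refine contMDiffAt_id.congr_of_eventuallyEq ?_
    filter_upwards [e.open_target.mem_nhds hy] with z hz using e.right_inv hz
  exact (ContMDiffAt.subtypeVal_comp_iff U _ y).1 h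

/-- A space homeomorphic to a manifold is a manifold for any equivalent model. -/
theorem Homeomorph.exists_diffeomorph [IsManifold I ∞ N] {X : Type*} [TopologicalSpace X]
    (e : X ≃ₜ N) (l : H ≃ₜ H') (A : E ≃L[ℝ] E') (hl : ∀ y, J (l y) = A (I y)) :
    ∃ _ : ChartedSpace H' X, IsManifold J ∞ X ∧ ∃ Ψ : X ≃ₘ^∞⟮J, I⟯ N, ⇑Ψ = e := by
  -- Charts of `N` pulled back along `e` and reread through `l`; in them `e` becomes the linear map
  -- `A.symm`.
  let c : OpenPartialHomeomorph N H → OpenPartialHomeomorph X H' := fun d ↦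
    (e.toOpenPartialHomeomorph.trans d).trans l.toOpenPartialHomeomorph
  have hls : ∀ y, I (l.symm y) = A.symm (J y) := by
    intro y
    rw [← l.apply_symm_apply y, hl]
    simp
  let _ : ChartedSpace H' X :=
    { atlas := c '' atlas H N
      chartAt := fun x ↦ c (chartAt H (e x))
      mem_chart_source := fun x ↦ by simp [c]
      chart_mem_atlas := fun x ↦ ⟨_, chart_mem_atlas H _, rfl⟩ }
  have hchart : ∀ x : X, chartAt H' x = c (chartAt H (e x)) := fun x ↦ rfl
  have hm : IsManifold J ∞ X := by
    refine isManifold_of_contDiffOn _ _ _ ?_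
    rintro _ _ ⟨d, hd, rfl⟩ ⟨d', hd', rfl⟩
    have h1 := (contDiffGroupoid ∞ I).compatible hd hd'
    rw [contDiffGroupoid, mem_groupoid_of_pregroupoid] at h1
    have h2 : ContDiffOn ℝ ∞ (I ∘ (d.symm.trans d') ∘ I.symm)
      (I.symm ⁻¹' (d.symm.trans d').source ∩ Set.range I) := h1.1
    have h3 := A.contDiff.comp_contDiffOn (h2.comp (t := _) A.symm.contDiff.contDiffOn
      (s := J.symm ⁻¹' ((c d).symm.trans (c d')).source ∩ Set.range J) ?_)
    · refine h3.congr ?_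
      rintro _ ⟨-, y, rfl⟩
      simp [c, hl, ← hls]
    · rintro _ ⟨hy, y, rfl⟩
      rw [← hls]
      refine ⟨?_, Set.mem_range_self _⟩
      simpa [c] using hy
  have h1 : ∀ x : X, Set.EqOn (extChartAt I (e x) ∘ e ∘ (extChartAt J x).symm) A.symm
      (extChartAt J x).target := by
    intro x y hy
    obtain ⟨y, rfl⟩ := extChartAt_target_subset_range x hy
    have hy' : l.symm y ∈ (chartAt H (e x)).target := by
      simpa [extChartAt, hchart, c] using hy
    simp [extChartAt, hchart, c, ← hls, hy']
  have h2 : ∀ x : X, Set.EqOn (extChartAt J x ∘ e.symm ∘ (extChartAt I (e x)).symm) A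
      (extChartAt I (e x)).target := by
    intro x y hy
    obtain ⟨y, rfl⟩ := extChartAt_target_subset_range _ hy
    have hy' : y ∈ (chartAt H (e x)).target := by
      simpa [extChartAt] using hy
    simp [extChartAt, hchart, c, hl, hy']
  refine ⟨inferInstance, hm, { e.toEquiv with
    contMDiff_toFun := fun x ↦ ?_
    contMDiff_invFun := fun x ↦ ?_ }, rfl⟩
  · refine contMDiffAt_iff.2 ⟨e.continuous.continuousAt, ?_⟩
    exact A.symm.contDiff.contDiffWithinAt.congr_of_eventuallyEq_of_mem
      (Filter.eventuallyEq_of_mem (extChartAt_target_mem_nhdsWithin x) (h1 x))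
      (extChartAt_target_subset_range x (mem_extChartAt_target x))
  · obtain ⟨x, rfl⟩ := e.surjective x
    refine contMDiffAt_iff.2 ⟨e.symm.continuous.continuousAt, ?_⟩
    change ContDiffWithinAt ℝ ∞ (extChartAt J (e.symm (e x)) ∘ e.symm ∘ _) _ _
    rw [e.symm_apply_apply]
    exact A.contDiff.contDiffWithinAt.congr_of_eventuallyEq_of_mem
      (Filter.eventuallyEq_of_mem (extChartAt_target_mem_nhdsWithin _) (h2 x))
      (extChartAt_target_subset_range _ (mem_extChartAt_target _))

end Manifolds

/-! ### Smoothness and countability for the leaf topology -/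

namespace Foliation

variable {p q : ℕ} {M : Type*} [TopologicalSpace M]
  [ChartedSpace (EuclideanSpace ℝ (Fin (p + q))) M]

theorem leafChart_mem_maximalAtlas (F : Foliation p q M)
    {φ : OpenPartialHomeomorph M (EuclideanSpace ℝ (Fin p) × EuclideanSpace ℝ (Fin q))}
    (hφ : φ ∈ F.charts) (t : EuclideanSpace ℝ (Fin q)) :
    F.leafChart φ hφ t ∈ IsManifold.maximalAtlas (𝓡 p) ∞ F.Leafwise :=
  IsManifold.subset_maximalAtlas ⟨φ, hφ, t, rfl⟩

/-- In a foliated chart, a plaque is included by $u\mapsto(u,t)$ with $t$ fixed. -/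
theorem contMDiff_toM (F : Foliation p q M) : ContMDiff (𝓡 p) (𝓡 (p + q)) ∞ F.toM := by
  intro x
  obtain ⟨φ, hφ, hx⟩ := F.exists_chart (F.toM x)
  let t := (φ (F.toM x)).2
  let e := F.leafChart φ hφ t
  have hxe : x ∈ e.source := ⟨hx, rfl⟩
  have h1 : ContMDiffAt (𝓡 p) 𝓘(ℝ, EuclideanSpace ℝ (Fin p) × EuclideanSpace ℝ (Fin q)) ∞
      (fun y ↦ (e y, t)) x :=
    (contMDiffAt_of_mem_maximalAtlas (F.leafChart_mem_maximalAtlas hφ t) hxe).prodMk_space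
      contMDiffAt_const
  have h2 : ContMDiffAt 𝓘(ℝ, EuclideanSpace ℝ (Fin p) × EuclideanSpace ℝ (Fin q)) (𝓡 (p + q)) ∞
      φ.symm (e x, t) :=
    (F.contMDiffOn_chart_symm φ hφ).contMDiffAt (φ.open_target.mem_nhds (φ.map_source hx))
  refine (h2.comp x h1).congr_of_eventuallyEq ?_
  filter_upwards [e.open_source.mem_nhds hxe] with y hy
  exact (e.left_inv hy).symm

/-- A map into a foliated manifold that is continuous for the leaf topology is smooth as a map into
the leaves if it is smooth. -/
theorem contMDiff_leafwise (F : Foliation p q M) {E H N : Type*} [NormedAddCommGroup E]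
    [NormedSpace ℝ E] [TopologicalSpace H] {I : ModelWithCorners ℝ E H} [TopologicalSpace N]
    [ChartedSpace H N] {f : N → F.Leafwise} (hc : Continuous f)
    (hf : ContMDiff I (𝓡 (p + q)) ∞ (F.toM ∘ f)) : ContMDiff I (𝓡 p) ∞ f := by
  intro x
  obtain ⟨φ, hφ, hx⟩ := F.exists_chart (F.toM (f x))
  let e := F.leafChart φ hφ (φ (F.toM (f x))).2
  have hxe : f x ∈ e.source := ⟨hx, rfl⟩
  have h1 : ContMDiffAt I 𝓘(ℝ, EuclideanSpace ℝ (Fin p) × EuclideanSpace ℝ (Fin q)) ∞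
      (φ ∘ F.toM ∘ f) x :=
    ((F.contMDiffOn_chart φ hφ).contMDiffAt (φ.open_source.mem_nhds hx)).comp x (hf x)
  have h2 : ContMDiffAt I (𝓡 p) ∞ (fun y ↦ e (f y)) x :=
    contDiff_fst.contMDiff.contMDiffAt.comp x h1
  have h3 : ContMDiffAt (𝓡 p) (𝓡 p) ∞ e.symm (e (f x)) :=
    contMDiffAt_symm_of_mem_maximalAtlas (F.leafChart_mem_maximalAtlas hφ _) (e.map_source hxe)
  refine (h3.comp x h2).congr_of_eventuallyEq ?_
  -- Leafwise continuity keeps nearby values in the plaque of `f x`.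
  filter_upwards [hc.continuousAt (e.open_source.mem_nhds hxe)] with y hy
  exact (e.left_inv hy).symm

/-- Countably many foliated charts cover `M`. The plaques of one chart may be uncountably many, but
they are disjoint, open and separable. -/
theorem isSeparable_connectedComponent [SecondCountableTopology M] (F : Foliation p q M)
    (x : F.Leafwise) : IsSeparable (connectedComponent x) := by
  choose φ hφ hx using F.exists_chart
  obtain ⟨s, hs, hsu⟩ := TopologicalSpace.countable_cover_nhds fun x ↦ (φ x).open_source.mem_nhds (hx x)
  have := hs.to_subtype
  refine isSeparable_connectedComponent_of_iUnion (ι := s)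
    (U := fun i t ↦ (F.leafChart (φ i) (hφ i) t).source)
    (fun i t ↦ OpenPartialHomeomorph.open_source _)
    (fun i t t' htt' ↦ ?_) (fun i t ↦ ?_) (fun y ↦ ?_) x
  · exact Set.disjoint_left.2 fun y hy hy' ↦ htt' (hy.2.symm.trans hy'.2)
  · rw [← OpenPartialHomeomorph.symm_image_target_eq_source]
    exact (OpenPartialHomeomorph.continuousOn_symm _).isSeparable_image'
  · obtain ⟨i, hi, hy⟩ := Set.mem_iUnion₂.1 (hsu ▸ Set.mem_univ (F.toM y))
    exact ⟨⟨i, hi⟩, _, hy, rfl⟩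

theorem Leaf.isSeparable [SecondCountableTopology M] {F : Foliation p q M} (L : F.Leaf) :
    IsSeparable (L.1 : Set F.Leafwise) := by
  obtain ⟨L, x, hx⟩ := L
  exact hx ▸ F.isSeparable_connectedComponent x

/-- A leaf meets only countably many plaques of a foliated chart. -/
theorem Leaf.countable_transverse [SecondCountableTopology M] {F : Foliation p q M} (L : F.Leaf)
    {φ : OpenPartialHomeomorph M (EuclideanSpace ℝ (Fin p) × EuclideanSpace ℝ (Fin q))}
    (hφ : φ ∈ F.charts) : {t | ∃ x ∈ L.carrier, x ∈ φ.source ∧ (φ x).2 = t}.Countable := by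
  refine (L.isSeparable.countable_setOf_inter_nonempty
    (U := fun t ↦ (F.leafChart φ hφ t).source) (fun t ↦ OpenPartialHomeomorph.open_source _)
    fun t t' htt' ↦ ?_).mono ?_
  · exact Set.disjoint_left.2 fun y hy hy' ↦ htt' (hy.2.symm.trans hy'.2)
  · rintro t ⟨x, hxL, hx, ht⟩
    exact ⟨F.ofM x, ⟨hx, ht⟩, hxL⟩

theorem mem_leafThrough (F : Foliation p q M) (x : M) : x ∈ (F.leafThrough x).carrier :=
  mem_connectedComponent (x := F.ofM x)

/-- A continuous map from a locally connected space to a foliated manifold that maps connected sets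
into leaves is continuous for the leaf topology. -/
theorem continuous_leafwise [SecondCountableTopology M] (F : Foliation p q M) {N : Type*}
    [TopologicalSpace N] [LocallyConnectedSpace N] {f : N → F.Leafwise}
    (hf : Continuous (F.toM ∘ f))
    (hL : ∀ x, ∃ L : F.Leaf, ∀ y ∈ connectedComponent x, F.toM (f y) ∈ L.carrier) :
    Continuous f := by
  refine continuous_iff_continuousAt.2 fun x ↦ tendsto_nhds_generateFrom_iff.2 ?_
  rintro V ⟨φ, hφ, U, hU, t, rfl⟩ ⟨hxU, hxφ, hxt⟩
  have hxt' : (φ ((F.toM ∘ f) x)).2 = t := hxt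
  have ho : IsOpen ((F.toM ∘ f) ⁻¹' φ.source) := φ.open_source.preimage hf
  obtain ⟨L, hL⟩ := hL x
  let W := connectedComponentIn ((F.toM ∘ f) ⁻¹' φ.source) x
  have hWφ : W ⊆ (F.toM ∘ f) ⁻¹' φ.source := connectedComponentIn_subset _ _
  have hxW : x ∈ W := mem_connectedComponentIn hxφ
  have hWx : W ⊆ connectedComponent x :=
    isPreconnected_connectedComponentIn.subset_connectedComponent hxW
  have hcont : ContinuousOn (fun y ↦ (φ ((F.toM ∘ f) y)).2) W :=
    continuous_snd.comp_continuousOn (φ.continuousOn.comp hf.continuousOn hWφ)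
  -- A countable subset of $\mathbb R^q$ is totally disconnected, so the transverse coordinate is
  -- constant on the connected set `W`.
  have hsub := (L.countable_transverse hφ).isTotallyDisconnected _ (by
      rintro _ ⟨y, hy, rfl⟩
      exact ⟨_, hL y (hWx hy), hWφ hy, rfl⟩)
    (isPreconnected_connectedComponentIn.image _ hcont)
  filter_upwards [hf.continuousAt (hU.mem_nhds hxU), ho.connectedComponentIn.mem_nhds hxW]
    with y hyU hyW
  exact ⟨hyU, hWφ hyW, (hsub ⟨y, hyW, rfl⟩ ⟨x, hxW, rfl⟩).trans hxt'⟩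

end Foliation


/-! ### The map from `G × L` to `M` and its fibres -/

namespace Foliation.IsInvariantUnderTransverseAction

variable {p q : ℕ} {M : Type*} [TopologicalSpace M]
  [ChartedSpace (EuclideanSpace ℝ (Fin (p + q))) M]
  {G : Type*} [TopologicalSpace G] [ChartedSpace (EuclideanSpace ℝ (Fin q)) G] [Group G]
  [MulAction G M] {F : Foliation p q M}

/-- The image of `L` under `g` is a leaf, and leaves sharing a point coincide. -/
theorem smul_mem_iff (hF : F.IsInvariantUnderTransverseAction G) (L : F.Leaf) {g : G} :
    g ∈ hF.leafSubgroup L ↔ ∃ x ∈ L.carrier, g • x ∈ L.carrier := by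
  constructor
  · intro hg
    obtain ⟨x, hx⟩ := L.nonempty
    exact ⟨x, hx, hg x hx⟩
  · rintro ⟨x, hx, hgx⟩ y hy
    obtain ⟨L', hL'⟩ := hF.map_leaf g L
    rw [Leaf.carrier_eq_of_mem hgx (hL' ▸ ⟨x, hx, rfl⟩ : g • x ∈ L'.carrier), ← hL']
    exact ⟨y, hy, rfl⟩

/-- The map `(g, l) ↦ g • l` from `G × L` to `M`. -/
def sweep (_hF : F.IsInvariantUnderTransverseAction G) (L : F.Leaf) (z : G × L.1) : M :=
  z.1 • F.toM z.2

variable (hF : F.IsInvariantUnderTransverseAction G) (L : F.Leaf)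

/-- If $g\cdot l=g'\cdot l'$, then $g^{-1}g'$ takes $l'\in L$ to $l\in L$, so it lies in $H(L)$ by
`smul_mem_iff`. -/
theorem sweep_eq_iff {z w : G × L.1} :
    hF.sweep L z = hF.sweep L w ↔ ∃ h : hF.LeafGroup L, h • w = z := by
  constructor
  · intro h
    have h1 : (z.1⁻¹ * w.1) • F.toM w.2 = F.toM z.2 := by
      rw [mul_smul, inv_smul_eq_iff]
      exact h.symm
    refine ⟨⟨z.1⁻¹ * w.1, (hF.smul_mem_iff L).2 ⟨F.toM w.2, w.2.2, ?_⟩⟩, ?_⟩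
    · rw [h1]
      exact z.2.2
    · refine Prod.ext ?_ (Subtype.ext h1)
      change w.1 * (z.1⁻¹ * w.1)⁻¹ = z.1
      simp
  · rintro ⟨h, rfl⟩
    change (w.1 * (hF.incl L h)⁻¹) • (hF.incl L h • F.toM w.2) = w.1 • F.toM w.2
    simp [mul_smul]

theorem eq_one_of_smul_eq {h : hF.LeafGroup L} {z : G × L.1} (hz : h • z = z) : h = 1 := by
  have h1 : z.1 * (hF.incl L h)⁻¹ = z.1 := congrArg Prod.fst hz
  have h2 : hF.incl L h = 1 := by simpa using h1
  exact Subtype.ext h2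

theorem image_slice (g : G) : hF.sweep L '' ({g} ×ˢ Set.univ) = (fun x ↦ g • x) '' L.carrier := by
  ext y
  constructor
  · rintro ⟨⟨a, l⟩, ⟨rfl, -⟩, rfl⟩
    exact ⟨F.toM l, l.2, rfl⟩
  · rintro ⟨x, hx, rfl⟩
    exact ⟨(g, ⟨F.ofM x, hx⟩), ⟨rfl, trivial⟩, rfl⟩

/-! ### Smoothness, surjectivity and properness -/

section Smooth

variable [ContMDiffSMul (𝓡 q) (𝓡 (p + q)) ∞ G M]

/-- The action of an element of the group is smooth for the leaf topology. -/
theorem contMDiff_smul_leafwise [SecondCountableTopology M]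
    (hF : F.IsInvariantUnderTransverseAction G) (g : G) :
    ContMDiff (𝓡 p) (𝓡 p) ∞ fun x : F.Leafwise ↦ F.ofM (g • F.toM x) := by
  have h : ContMDiff (𝓡 p) (𝓡 (p + q)) ∞ (F.toM ∘ fun x : F.Leafwise ↦ F.ofM (g • F.toM x)) :=
    (ContMDiffSMul.contMDiff_const_smul (I := 𝓡 q) g).comp F.contMDiff_toM
  refine F.contMDiff_leafwise (F.continuous_leafwise h.continuous fun x ↦ ?_) h
  -- Components of the leaf topology are leaves, so `map_leaf` supplies the hypothesis of
  -- `continuous_leafwise`.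
  obtain ⟨L', hL'⟩ := hF.map_leaf g (F.leafThrough (F.toM x))
  exact ⟨L', fun y hy ↦ hL' ▸ ⟨F.toM y, hy, rfl⟩⟩

theorem contMDiff_smul_leaf [SecondCountableTopology M] (h : hF.LeafGroup L) :
    ContMDiff (𝓡 p) (𝓡 p) ∞ fun l : L.1 ↦ h • l :=
  (ContMDiff.subtypeVal_comp_iff L.1 _).1
    ((hF.contMDiff_smul_leafwise (hF.incl L h)).comp contMDiff_subtype_val)

theorem contMDiff_smul_prod [SecondCountableTopology M] [LieGroup (𝓡 q) ∞ G]
    (h : hF.LeafGroup L) :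
    ContMDiff ((𝓡 q).prod (𝓡 p)) ((𝓡 q).prod (𝓡 p)) ∞ fun z : G × L.1 ↦ h • z :=
  (contMDiff_fst.mul contMDiff_const).prodMk ((hF.contMDiff_smul_leaf L h).comp contMDiff_snd)

theorem contMDiff_sweep : ContMDiff ((𝓡 q).prod (𝓡 p)) (𝓡 (p + q)) ∞ (hF.sweep L) :=
  contMDiff_fst.smul (I := 𝓡 q)
    (F.contMDiff_toM.comp (contMDiff_subtype_val.comp contMDiff_snd))

/-- The two partial derivatives have as ranges the tangent spaces of the orbit and of the leaf,
which together span; equality of dimensions does the rest. -/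
theorem isInvertible_mfderiv_sweep_one [IsManifold (𝓡 q) ∞ G] (l : L.1) :
    (mfderiv ((𝓡 q).prod (𝓡 p)) (𝓡 (p + q)) (hF.sweep L) (1, l)).IsInvertible := by
  have hd := (hF.contMDiff_sweep L (1, l)).mdifferentiableAt (by simp)
  refine ContinuousLinearMap.isInvertible_of_surjective_of_finrank_eq
    (V := EuclideanSpace ℝ (Fin q) × EuclideanSpace ℝ (Fin p))
    (W := EuclideanSpace ℝ (Fin (p + q))) (fun w ↦ ?_) (by simp [add_comm])
  -- Transversality is stated at `1 • F.toM l`; `h1` moves the leaf tangent space to `F.toM l`.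
  have h1 : ∀ y, y = F.toM l → ∀ w : EuclideanSpace ℝ (Fin (p + q)),
      w ∈ F.tangentSpace y → w ∈ F.tangentSpace (F.toM l) := by
    rintro _ rfl w hw
    exact hw
  have h2 : ∀ f : L.1 → M, f = F.toM ∘ Subtype.val → ∀ v : EuclideanSpace ℝ (Fin p),
      (mfderiv (𝓡 p) (𝓡 (p + q)) f l v : EuclideanSpace ℝ (Fin (p + q))) =
        mfderiv (𝓡 p) (𝓡 (p + q)) F.toM l
          (mfderiv (𝓡 p) (𝓡 p) (Subtype.val : L.1 → F.Leafwise) l v) := by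
    rintro _ rfl v
    rw [mfderiv_comp l (F.contMDiff_toM.mdifferentiableAt (by simp))
      (contMDiff_subtype_val.mdifferentiableAt (n := ∞) (by simp))]
    rfl
  have hT := hF.transverse (F.toM l) 1
  let w' : TangentSpace (𝓡 (p + q)) ((1 : G) • F.toM l) := w
  have hw := (SetLike.ext_iff.1 hT w').2 trivial
  obtain ⟨_, ⟨v₁, rfl⟩, w₂, hw₂, hww⟩ := Submodule.mem_sup.1 hw
  obtain ⟨u, rfl⟩ := h1 _ (one_smul G _) _ hw₂
  obtain ⟨v₂, hv₂⟩ :=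
    (L.1.isLocalDiffeomorph_subtypeVal (I := 𝓡 p) l).isInvertible_mfderiv.surjective u
  refine ⟨(v₁, v₂), ?_⟩
  refine (mfderiv_prod_eq_add_apply hd).trans (Eq.trans ?_ hww)
  refine congrArg₂ (fun a b : EuclideanSpace ℝ (Fin (p + q)) ↦ a + b) rfl ?_
  refine (h2 _ (funext fun x ↦ one_smul G _) v₂).trans ?_
  exact congrArg _ hv₂

variable [IsManifold (𝓡 (p + q)) ∞ M]

/-- Translating by $g^{-1}$ in the source and by $g$ in the target reduces the point $(g,l)$ to
$(1,l)$. -/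
theorem isLocalDiffeomorph_sweep [LieGroup (𝓡 q) ∞ G] :
    IsLocalDiffeomorph ((𝓡 q).prod (𝓡 p)) (𝓡 (p + q)) ∞ (hF.sweep L) := by
  refine (hF.contMDiff_sweep L).isLocalDiffeomorph_of_isInvertible ?_
  rintro ⟨g, l⟩
  let A : (G × L.1) ≃ₘ^∞⟮(𝓡 q).prod (𝓡 p), (𝓡 q).prod (𝓡 p)⟯ (G × L.1) :=
    (Diffeomorph.smul (𝓡 q) (𝓡 q) ∞ g⁻¹).prodCongr (Diffeomorph.refl (𝓡 p) L.1 ∞)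
  let B : M ≃ₘ^∞⟮𝓡 (p + q), 𝓡 (p + q)⟯ M := Diffeomorph.smul (𝓡 q) (𝓡 (p + q)) ∞ g
  have hA : A (g, l) = (1, l) := Prod.ext (inv_mul_cancel g) rfl
  have h : hF.sweep L = B ∘ hF.sweep L ∘ A := by
    ext z
    change z.1 • F.toM z.2 = g • (g⁻¹ * z.1) • F.toM z.2
    rw [mul_smul, smul_inv_smul]
  have hs : (mfderiv ((𝓡 q).prod (𝓡 p)) (𝓡 (p + q)) (hF.sweep L) (A (g, l))).IsInvertible :=
    hA ▸ hF.isInvertible_mfderiv_sweep_one L l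
  have hB := (B.isLocalDiffeomorph (hF.sweep L (A (g, l)))).isInvertible_mfderiv
  have hd := (hF.contMDiff_sweep L).mdifferentiable (by simp)
  rw [h, mfderiv_comp _ (B.mdifferentiable (by simp) _)
    ((hd _).comp _ (A.mdifferentiable (by simp) _)), mfderiv_comp _ (hd _)
    (A.mdifferentiable (by simp) _)]
  exact hB.comp (hs.comp (A.isLocalDiffeomorph (g, l)).isInvertible_mfderiv)

theorem sweep_surjective [LieGroup (𝓡 q) ∞ G] [ConnectedSpace M] :
    Function.Surjective (hF.sweep L) := by
  have ho : ∀ L' : F.Leaf, IsOpen (Set.range (hF.sweep L')) := fun L' ↦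
    (hF.isLocalDiffeomorph_sweep L').isOpen_range
  rw [← Set.range_eq_univ]
  refine IsClopen.eq_univ ⟨⟨?_⟩, ho L⟩ ?_
  · refine isOpen_iff_forall_mem_open.2 fun x hx ↦
      ⟨Set.range (hF.sweep (F.leafThrough x)), ?_, ho _,
        (1, ⟨F.ofM x, F.mem_leafThrough x⟩), one_smul G x⟩
    rintro _ ⟨⟨g, y⟩, rfl⟩ ⟨⟨a, l⟩, hal⟩
    have h1 : a • F.toM l = g • F.toM y := hal
    obtain ⟨L', hL'⟩ := hF.map_leaf (g⁻¹ * a) L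
    have h2 : F.toM y ∈ L'.carrier := hL' ▸ ⟨F.toM l, l.2, by
      change (g⁻¹ * a) • F.toM l = F.toM y
      rw [mul_smul, h1, inv_smul_smul]⟩
    have h3 : x ∈ L'.carrier :=
      Leaf.carrier_eq_of_mem (L := F.leafThrough x) y.2 h2 ▸ F.mem_leafThrough x
    rw [← hL'] at h3
    obtain ⟨z, hz, rfl⟩ := h3
    exact hx ⟨(g⁻¹ * a, ⟨F.ofM z, hz⟩), rfl⟩
  · obtain ⟨x, hx⟩ := L.nonempty
    exact ⟨_, (1, ⟨F.ofM x, hx⟩), rfl⟩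

/-- By surjectivity of `sweep` every leaf contains some $g\cdot l$ with $l\in L$, so it is the leaf
$g\cdot L$. -/
theorem exists_smul_carrier_eq [LieGroup (𝓡 q) ∞ G] [ConnectedSpace M]
    (hF : F.IsInvariantUnderTransverseAction G) (L : F.Leaf) (S : Set M) :
    (∃ L' : F.Leaf, L'.carrier = S) ↔ ∃ g : G, S = (fun x ↦ g • x) '' L.carrier := by
  constructor
  · rintro ⟨L', rfl⟩
    obtain ⟨x, hx⟩ := L'.nonempty
    obtain ⟨⟨g, l⟩, rfl⟩ := hF.sweep_surjective L x
    obtain ⟨L'', h⟩ := hF.map_leaf g L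
    exact ⟨g, (Leaf.carrier_eq_of_mem hx (h ▸ ⟨F.toM l, l.2, rfl⟩)).trans h.symm⟩
  · rintro ⟨g, rfl⟩
    obtain ⟨L', h⟩ := hF.map_leaf g L
    exact ⟨L', h.symm⟩

theorem properSMul [SecondCountableTopology M] [LieGroup (𝓡 q) ∞ G] [T2Space M] : ProperSMul (hF.LeafGroup L) (G × L.1) := by
  have : ContinuousConstSMul (hF.LeafGroup L) (G × L.1) :=
    ⟨fun h ↦ (hF.contMDiff_smul_prod L h).continuous⟩
  refine properSMul_of_locally_injective (hF.contMDiff_sweep L).continuous (fun z ↦ ?_)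
    (fun z w ↦ hF.sweep_eq_iff L) fun h z ↦ hF.eq_one_of_smul_eq L
  obtain ⟨Φ, hz, hΦ⟩ := hF.isLocalDiffeomorph_sweep L z
  exact ⟨Φ.source, Φ.open_source.mem_nhds hz, hΦ.injOn_iff.2 Φ.toPartialEquiv.injOn⟩

variable [LieGroup (𝓡 q) ∞ G] [ConnectedSpace M]

/-- The homeomorphism from `(G × L) / H(L)` to `M` induced by `(g, l) ↦ g • l`. -/
def modelHomeomorph : hF.AlgebraicModel L ≃ₜ M :=
  (Equiv.ofBijective (Quotient.lift (hF.sweep L) fun _ _ h ↦ (hF.sweep_eq_iff L).2 h) (by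
    constructor
    · rintro ⟨z⟩ ⟨w⟩ h
      exact Quotient.sound ((hF.sweep_eq_iff L).1 h)
    · intro x
      obtain ⟨z, rfl⟩ := hF.sweep_surjective L x
      exact ⟨hF.proj L z, rfl⟩)).toHomeomorphOfContinuousOpen
    ((hF.contMDiff_sweep L).continuous.quotient_lift _) (by
      intro U hU
      have h : Quotient.lift (hF.sweep L) (fun _ _ h ↦ (hF.sweep_eq_iff L).2 h) '' U =
          hF.sweep L '' (hF.proj L ⁻¹' U) := by
        ext x
        constructor
        · rintro ⟨⟨z⟩, hz, rfl⟩
          exact ⟨z, hz, rfl⟩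
        · rintro ⟨z, hz, rfl⟩
          exact ⟨hF.proj L z, hz, rfl⟩
      exact h ▸ (hF.isLocalDiffeomorph_sweep L).isOpenMap _
        (hU.preimage continuous_quotient_mk'))

theorem exists_model_diffeomorph : ∃ _ : ChartedSpace
      (ModelProd (EuclideanSpace ℝ (Fin q)) (EuclideanSpace ℝ (Fin p))) (hF.AlgebraicModel L),
    IsManifold ((𝓡 q).prod (𝓡 p)) ∞ (hF.AlgebraicModel L) ∧
      ∃ Ψ : hF.AlgebraicModel L ≃ₘ^∞⟮(𝓡 q).prod (𝓡 p), 𝓡 (p + q)⟯ M,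
        ⇑Ψ = hF.modelHomeomorph L := by
  -- Any linear isomorphism will do: it only changes the model space of the pulled-back charts.
  let A : EuclideanSpace ℝ (Fin (p + q)) ≃L[ℝ]
      EuclideanSpace ℝ (Fin q) × EuclideanSpace ℝ (Fin p) :=
    ContinuousLinearEquiv.ofFinrankEq (by simp [add_comm])
  exact (hF.modelHomeomorph L).exists_diffeomorph A.toHomeomorph A fun y ↦ rfl

end Smooth

end Foliation.IsInvariantUnderTransverseAction

end

/-! ### The structure theorem -/

theorem theorem1 {p q : ℕ}
    {M : Type*} [TopologicalSpace M] [ChartedSpace (EuclideanSpace ℝ (Fin (p + q))) M]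
    [IsManifold (𝓡 (p + q)) ∞ M] [T2Space M] [SecondCountableTopology M] [ConnectedSpace M]
    {G : Type*} [TopologicalSpace G] [ChartedSpace (EuclideanSpace ℝ (Fin q)) G] [Group G]
    [LieGroup (𝓡 q) ∞ G] [MulAction G M] [ContMDiffSMul (𝓡 q) (𝓡 (p + q)) ∞ G M]
    (F : Foliation p q M) (hF : F.IsInvariantUnderTransverseAction G) (L : F.Leaf) :
    -- membership in `H(L)` can be tested at every point, or at a single point, of the leaf
    (∀ g : G, g ∈ hF.leafSubgroup L ↔ ∀ x ∈ L.carrier, g • x ∈ L.carrier) ∧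
    (∀ g : G, g ∈ hF.leafSubgroup L ↔ ∃ x ∈ L.carrier, g • x ∈ L.carrier) ∧
    -- the discrete group `H(L)` acts on `G × L` by the stated formula, smoothly, properly, freely
    (∀ (h : hF.LeafGroup L) (g : G) (l : L.1),
      (h • (g, l)).1 = g * (hF.incl L h)⁻¹ ∧
      F.toM (h • (g, l)).2 = hF.incl L h • F.toM l) ∧
    (∀ h : hF.LeafGroup L, ContMDiff ((𝓡 q).prod (𝓡 p)) ((𝓡 q).prod (𝓡 p)) ∞
      (fun z : G × L.1 ↦ h • z)) ∧
    ProperSMul (hF.LeafGroup L) (G × L.1) ∧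
    (∀ (h : hF.LeafGroup L) (z : G × L.1), h • z = z → h = 1) ∧
    -- the orbit space is a smooth quotient manifold, `G`-equivariantly diffeomorphic to `M`
    ∃ _ : ChartedSpace
        (ModelProd (EuclideanSpace ℝ (Fin q)) (EuclideanSpace ℝ (Fin p))) (hF.AlgebraicModel L),
      IsManifold ((𝓡 q).prod (𝓡 p)) ∞ (hF.AlgebraicModel L) ∧
      IsLocalDiffeomorph ((𝓡 q).prod (𝓡 p)) ((𝓡 q).prod (𝓡 p)) ∞ (hF.proj L) ∧
      ∃ Ψ : hF.AlgebraicModel L ≃ₘ^∞⟮(𝓡 q).prod (𝓡 p), 𝓡 (p + q)⟯ M,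
        (∀ (g : G) (l : L.1), Ψ (hF.proj L (g, l)) = g • F.toM l) ∧
        (∀ (a : G) (z : hF.AlgebraicModel L), Ψ (a • z) = a • Ψ z) ∧
        -- the leaves are the images of the slices
        ∀ S : Set M, (∃ L' : F.Leaf, L'.carrier = S) ↔
          ∃ g : G, S = Ψ '' (hF.proj L '' ({g} ×ˢ Set.univ)) := by
  refine ⟨fun g ↦ Iff.rfl, fun g ↦ hF.smul_mem_iff L, fun h g l ↦ ⟨rfl, rfl⟩,
    hF.contMDiff_smul_prod L, hF.properSMul L, fun h z ↦ hF.eq_one_of_smul_eq L, ?_⟩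
  obtain ⟨_, hm, Ψ, hΨ⟩ := hF.exists_model_diffeomorph L
  have hproj : ∀ z, Ψ (hF.proj L z) = hF.sweep L z := fun z ↦ congrFun hΨ _
  refine ⟨inferInstance, hm, fun z ↦ ?_, Ψ, fun g l ↦ hproj _, ?_, fun S ↦ ?_⟩
  -- The projection is `Ψ.symm` after `sweep`, a composite of local diffeomorphisms.
  · refine ((hF.isLocalDiffeomorph_sweep L z).comp _ _
      (Ψ.symm.isLocalDiffeomorph _)).congr_of_eventuallyEq (.of_forall fun w ↦ ?_)
    rw [Function.comp_apply, ← hproj, Ψ.symm_apply_apply]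
  · rintro a ⟨z⟩
    exact (hproj _).trans ((mul_smul _ _ _).trans (congrArg _ (hproj z).symm))
  · simp only [hF.exists_smul_carrier_eq L, ← hF.image_slice, Set.image_image, hproj]
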